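/- **Theorem (Well-definedness of the MEM estimator).** Let either $\Omega=\mathbb R^d$ with dominating measure $\nu$ the Lebesgue measure, or $\Omega\subseteq\mathbb R^d$ countable with $\nu$ the counting measure, and let $\mathcal P(\Omega)$ be the set of probability measures on $\Omega$ that are absolutely continuous with respect to $\nu$. For $P\in\mathcal P(\Omega)$ write $\mathbb E_P=\int_\Omega y\,dP(y)$, let $\Omega_P$ be its support (the smallest relatively closed subset of $\Omega$ of full $P$-measure), $\Theta_P=\{\theta\in\mathbb R^d:\int_\Omega e^{\langle y,\theta\rangle}dP(y)<\infty\}$, let $\psi_P:\mathbb R^d\to(-\infty,+\infty]$ be $\psi_P(\theta)=\log\int_\Omega e^{\langle y,\theta\rangle}dP(y)$ for $\theta\in\Theta_P$ and $\psi_P(\theta)=+\infty$ otherwise, and let $\psi_P^*(y)=\sup_{\theta\in\mathbb R^d}\{\langle y,\theta\rangle-\psi_P(\theta)\}$ be its Fenchel conjugate (the Cramér rate function). For an extended-real-valued function $f$ let $\operatorname{dom} f=\{x:f(x)<+\infty\}$. Let $\Lambda\subseteq\mathbb R^d$ and let $F_\Lambda=\{P_\lambda:\lambda\in\Lambda\}\subset\mathcal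 P(\Omega)$ be a family such that $\mathbb E_{P_{\lambda_1}}=\mathbb E_{P_{\lambda_2}}$ if and only if $\lambda_1=\lambda_2$, and such that every $P=P_\lambda\in F_\Lambda$ satisfies the following conditions: 1. (minimality) the affine hulls of $\Theta_P$ and of the closed convex hull of $\Omega_P$ both have dimension $d$; 2. (steepness) $\psi_P$ is essentially smooth: $\operatorname{int}\operatorname{dom}\psi_P\ne\emptyset$, $\psi_P$ is differentiable on $\operatorname{int}\operatorname{dom}\psi_P$, and $\|\nabla\psi_P(x^k)\|\to\infty$ for every sequence $(x^k)$ in $\operatorname{int}\operatorname{dom}\psi_P$ that converges to a boundary point of $\operatorname{dom}\psi_P$; 3. $0\in\operatorname{int}\Theta_P$; 4. either $\Omega_P$ is uncountable, or $\Omega_P$ is countable and its convex hull $\operatorname{conv}\Omega_P$ is closed. Let $\hat y\in\mathbb R^d$, let $\hat\lambda\in\Lambda$ be such that $\hat y=\mathbb E_{P_{\hat\lambda}}$, and let $S^*\subseteq\mathbb R^d$ be closed with $S^*\cap\operatorname{dom}\psi^*_{P_{\hat\lambda}}\neq\emptyset$. Then the MEM estimator exists, that is, the set $$\operatorname{argmin}\{\psi^*_{P_{\hat\lambda}}(y):y\in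 S^*\}$$ is nonempty. If, in addition, $S^*$ is convex and $\operatorname{int}(\operatorname{dom}\psi^*_{P_{\hat\lambda}})\cap S^*\neq\emptyset$, then this set consists of exactly one point $y_{\rm MEM}$, and $y_{\rm MEM}\in\operatorname{int}(\operatorname{dom}\psi^*_{P_{\hat\lambda}})\cap S^*$. -/

import Mathlib

open MeasureTheory Set Filter Topology
open scoped InnerProductSpace

noncomputable section

namespace MEM

/-- The Euclidean space `ℝ^d`. -/
abbrev E (d : ℕ) : Type := EuclideanSpace ℝ (Fin d)

/-! ### Convex analysis for extended-real-valued functions -/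

/-- The effective domain `{x : f x < +∞}`. -/
def dom {d : ℕ} (f : E d → EReal) : Set (E d) := {x | f x < ⊤}

/-- The Fenchel conjugate `f^*(y) = sup_x (⟨y, x⟩ - f x)`. -/
def conjugate {d : ℕ} (f : E d → EReal) (y : E d) : EReal :=
  ⨆ x : E d, ((⟪y, x⟫_ℝ : ℝ) : EReal) - f x

/-- The gradient at `x`. It is only used at points of the interior of the domain of a function
that never takes the value `-∞`, where `f` is real-valued around `x`. -/
def grad {d : ℕ} (f : E d → EReal) (x : E d) : E d := gradient (fun z => (f z).toReal) x

/-- Essential smoothness of a (proper and convex) function. -/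
structure IsEssentiallySmooth {d : ℕ} (f : E d → EReal) : Prop where
  interior_dom_nonempty : (interior (dom f)).Nonempty
  differentiable : ∀ x ∈ interior (dom f), DifferentiableAt ℝ (fun z => (f z).toReal) x
  steep : ∀ (x : ℕ → E d) (xbar : E d), (∀ k, x k ∈ interior (dom f)) →
    xbar ∈ frontier (dom f) → Tendsto x atTop (𝓝 xbar) →
    Tendsto (fun k => ‖grad f (x k)‖) atTop atTop

/-- The dimension of the affine hull of a set. -/
def affineDim {d : ℕ} (S : Set (E d)) : ℕ := Module.finrank ℝ (affineSpan ℝ S).direction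

/-! ### Distributions

A measure on the measurable space `Ω ⊆ ℝ^d` is represented by its extension to `ℝ^d` by zero
outside `Ω`. -/

/-- The two admissible sample spaces with their dominating measures: `Ω = ℝ^d` with Lebesgue
measure, or a countable `Ω ⊆ ℝ^d` with the counting measure on `Ω`. -/
def IsSampleSpace {d : ℕ} (Ω : Set (E d)) (ν : Measure (E d)) : Prop :=
  (Ω = univ ∧ ν = volume) ∨ (Ω.Countable ∧ ν = Measure.count.restrict Ω)

/-- The set `𝓟(Ω)` of probability measures that are absolutely continuous with respect to the
dominating measure `ν` (so that they vanish outside `Ω`). -/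
def distributions {d : ℕ} (ν : Measure (E d)) : Set (Measure (E d)) :=
  {P | IsProbabilityMeasure P ∧ P ≪ ν}

/-- The support `Ω_P` of a measure on `Ω`: the smallest relatively closed subset of `Ω` whose
complement in `Ω` is a null set. -/
def supp {d : ℕ} (Ω : Set (E d)) (P : Measure (E d)) : Set (E d) := P.support ∩ Ω

/-- The convex support: the closed convex hull of the support. -/
def convexSupp {d : ℕ} (Ω : Set (E d)) (P : Measure (E d)) : Set (E d) :=
  closure (convexHull ℝ (supp Ω P))

/-- The expected value. -/
def mean {d : ℕ} (P : Measure (E d)) : E d := ∫ y, y ∂P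

/-- The natural parameter space `{θ : ∫ exp ⟨y, θ⟩ dP(y) < ∞}`. -/
def naturalParams {d : ℕ} (P : Measure (E d)) : Set (E d) :=
  {θ | ∫⁻ y, ENNReal.ofReal (Real.exp ⟪y, θ⟫_ℝ) ∂P < ⊤}

open scoped Classical in
/-- The log-normalizer (cumulant generating function) `ψ_P`. -/
def logNormalizer {d : ℕ} (P : Measure (E d)) (θ : E d) : EReal :=
  if θ ∈ naturalParams P then ((Real.log (∫ y, Real.exp ⟪y, θ⟫_ℝ ∂P) : ℝ) : EReal) else ⊤

/-- The Cramér rate function `ψ_P^*`. -/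
def cramer {d : ℕ} (P : Measure (E d)) : E d → EReal := conjugate (logNormalizer P)

/-- `P` generates a minimal exponential family. -/
def IsMinimal {d : ℕ} (Ω : Set (E d)) (P : Measure (E d)) : Prop :=
  affineDim (naturalParams P) = d ∧ affineDim (convexSupp Ω P) = d

/-- `P` generates a steep exponential family. -/
def IsSteep {d : ℕ} (P : Measure (E d)) : Prop := IsEssentiallySmooth (logNormalizer P)

/-- `P` generates a minimal and steep exponential family, and `0` is an interior point of its
natural parameter space. -/
structure MinimalSteep {d : ℕ} (Ω : Set (E d)) (P : Measure (E d)) : Prop where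
  minimal : IsMinimal Ω P
  steep : IsSteep P
  zero_mem : (0 : E d) ∈ interior (naturalParams P)

/-- The support is uncountable, or it is countable and its convex hull is closed. -/
def SupportCondition {d : ℕ} (Ω : Set (E d)) (P : Measure (E d)) : Prop :=
  ¬ (supp Ω P).Countable ∨ ((supp Ω P).Countable ∧ IsClosed (convexHull ℝ (supp Ω P)))

/-- A reference family: distributions `P_l` in `𝓟(Ω)` indexed by `l ∈ Λ ⊆ ℝ^d`, determined by
their means. -/
structure IsReferenceFamily {d : ℕ} (ν : Measure (E d)) (Λ : Set (E d))
    (P : Λ → Measure (E d)) : Prop where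
  mem : ∀ l, P l ∈ distributions ν
  mean_eq_iff : ∀ l₁ l₂, mean (P l₁) = mean (P l₂) ↔ l₁ = l₂

/-- The set of minimizers of `f` over `S`. -/
def argmin {d : ℕ} (f : E d → EReal) (S : Set (E d)) : Set (E d) :=
  {y | y ∈ S ∧ ∀ z ∈ S, f y ≤ f z}

end MEM

end

/-! Existence is the direct method. The rate function is lower semicontinuous, being a supremum of
continuous functions. Its sublevel sets are bounded because the cumulant is bounded above on a ball
around `0`.

For the second claim, approach a minimizer `y` along the segment from a point of `S` interior to the
domain. Near-maximizing parameters stay bounded, and Fatou's lemma makes their limit a maximizer `θ`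
in the supremum defining the rate at `y` (`exists_inner_sub_cumulant_eq`).

Such a `y` is interior (`mem_interior_dom_cramer`). Otherwise a hyperplane through `y` with normal
`n` supports the domain, and its half-space carries `P`. Since `P` is not concentrated on the
hyperplane, replacing `θ` by `θ + n` strictly improves the supremum.

For uniqueness, take the maximizing parameter at the midpoint of two minimizers. Both minimizers are
subgradients of the cumulant there, and steepness allows only one (`subgradient_unique`). -/

namespace MEM

variable {d : ℕ}

/-! ### Convex functions on Euclidean space -/

/-- A convex function is bounded above on a small closed ball around an interior point. -/
theorem _root_.ConvexOn.exists_closedBall_le {D : Set (E d)} {f : E d → ℝ} (hf : ConvexOn ℝ D f)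
    {x : E d} (hx : x ∈ interior D) :
    ∃ r > 0, ∃ M : ℝ, ∀ z ∈ Metric.closedBall x r, z ∈ D ∧ f z ≤ M := by
  have hcont : ContinuousAt f x :=
    hf.continuousOn_interior.continuousAt (isOpen_interior.mem_nhds hx)
  have h1 : ∀ᶠ z in 𝓝 x, z ∈ D ∧ f z ≤ f x + 1 := by
    filter_upwards [mem_interior_iff_mem_nhds.1 hx,
      hcont.eventually (eventually_le_nhds (lt_add_one (f x)))] with z h1 h2
    exact ⟨h1, h2⟩
  obtain ⟨r, hr, h⟩ := Metric.nhds_basis_closedBall.eventually_iff.1 h1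
  exact ⟨r, hr, f x + 1, fun z hz => h hz⟩

/-- A vector whose inner products with all vectors of norm at most `r` are at most `C` has norm
at most `C / r`. -/
theorem mul_norm_le_of_inner_le {r C : ℝ} (hr : 0 < r) {g : E d}
    (h : ∀ u : E d, ‖u‖ ≤ r → ⟪u, g⟫_ℝ ≤ C) : r * ‖g‖ ≤ C := by
  by_cases hg : ‖g‖ = 0
  · have := h 0 (by simpa using hr.le)
    simpa [hg] using this
  · have h1 := h ((r / ‖g‖) • g) (by
      rw [norm_smul, Real.norm_of_nonneg (by positivity)]
      field_simp; rfl)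
    rw [real_inner_smul_left, real_inner_self_eq_norm_sq] at h1
    have : r / ‖g‖ * ‖g‖ ^ 2 = r * ‖g‖ := by field_simp
    linarith

/-- The gradient inequality for convex functions. -/
theorem _root_.ConvexOn.add_inner_gradient_le {D : Set (E d)} {f : E d → ℝ} (hf : ConvexOn ℝ D f)
    {x z : E d} (hx : x ∈ D) (hz : z ∈ D) (hd : DifferentiableAt ℝ f x) :
    f x + ⟪gradient f x, z - x⟫_ℝ ≤ f z := by
  have hl := hd.hasFDerivAt.hasLineDerivAt (z - x)
  rw [HasLineDerivAt] at hl
  have h2 := hl.tendsto_slope_zero_right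
  have h3 : fderiv ℝ f x (z - x) ≤ f z - f x := by
    -- By convexity every difference quotient on the segment with `0 < t < 1` is at most `f z - f
    -- x`.
    refine le_of_tendsto h2 ?_
    filter_upwards [Ioo_mem_nhdsGT (zero_lt_one' ℝ)] with t ht
    have hc := hf.2 hx hz (by linarith [ht.2] : 0 ≤ 1 - t) ht.1.le (by ring)
    have he : x + (0 + t) • (z - x) = (1 - t) • x + t • z := by module
    rw [he]
    simp only [zero_smul, add_zero, smul_eq_mul] at hc ⊢
    rw [inv_mul_le_iff₀ ht.1]
    linarith
  have h4 : ⟪gradient f x, z - x⟫_ℝ = fderiv ℝ f x (z - x) := inner_gradient_left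
  linarith

/-! ### The cumulant generating function -/

/-- The real-valued version of the log-normalizer. -/
noncomputable def cumulant (P : Measure (E d)) (θ : E d) : ℝ := (logNormalizer P θ).toReal

/-- The Laplace transform with values in `[0, ∞]`. -/
noncomputable def laplace (P : Measure (E d)) (θ : E d) : ENNReal :=
  ∫⁻ y, ENNReal.ofReal (Real.exp ⟪y, θ⟫_ℝ) ∂P

theorem logNormalizer_of_mem {P : Measure (E d)} {θ : E d} (h : θ ∈ naturalParams P) :
    logNormalizer P θ = (cumulant P θ : EReal) := by
  simp [cumulant, logNormalizer, h]

theorem logNormalizer_of_notMem {P : Measure (E d)} {θ : E d} (h : θ ∉ naturalParams P) :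
    logNormalizer P θ = ⊤ := by
  simp [logNormalizer, h]

theorem dom_logNormalizer (P : Measure (E d)) : dom (logNormalizer P) = naturalParams P := by
  ext θ
  by_cases h : θ ∈ naturalParams P
  · simp [dom, logNormalizer_of_mem h, h]
  · simp [dom, logNormalizer_of_notMem h, h]

theorem mem_naturalParams {P : Measure (E d)} {θ : E d} :
    θ ∈ naturalParams P ↔ laplace P θ < ⊤ := Iff.rfl

theorem measurable_exp_inner (θ : E d) :
    Measurable fun y : E d => ENNReal.ofReal (Real.exp ⟪y, θ⟫_ℝ) :=
  (ENNReal.continuous_ofReal.comp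
    (by fun_prop : Continuous fun y : E d => Real.exp ⟪y, θ⟫_ℝ)).measurable

theorem laplace_pos (P : Measure (E d)) [IsProbabilityMeasure P] (θ : E d) : 0 < laplace P θ := by
  rw [laplace, lintegral_pos_iff_support (measurable_exp_inner θ)]
  have : (Function.support fun y : E d => ENNReal.ofReal (Real.exp ⟪y, θ⟫_ℝ)) = univ := by
    ext y; simp [Real.exp_pos]
  rw [this]; simp

theorem laplace_eq (P : Measure (E d)) [IsProbabilityMeasure P] {θ : E d}
    (h : θ ∈ naturalParams P) : laplace P θ = ENNReal.ofReal (Real.exp (cumulant P θ)) := by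
  have h1 : ∫ y, Real.exp ⟪y, θ⟫_ℝ ∂P = (laplace P θ).toReal :=
    integral_eq_lintegral_of_nonneg_ae (ae_of_all _ fun y => (Real.exp_pos _).le)
      (by fun_prop : Continuous fun y : E d => Real.exp ⟪y, θ⟫_ℝ).aestronglyMeasurable
  have h2 : 0 < (laplace P θ).toReal := ENNReal.toReal_pos (laplace_pos P θ).ne' h.ne
  have h3 : cumulant P θ = Real.log (laplace P θ).toReal := by
    simp [cumulant, logNormalizer, h, h1]
  rw [h3, Real.exp_log h2, ENNReal.ofReal_toReal (mem_naturalParams.1 h).ne]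

/-- A bound in `[0, ∞]` encodes finiteness and the bound on the cumulant together, so Hölder and
Fatou apply without integrability side conditions. -/
theorem laplace_le_iff (P : Measure (E d)) [IsProbabilityMeasure P] {θ : E d} {c : ℝ} :
    laplace P θ ≤ ENNReal.ofReal (Real.exp c) ↔ θ ∈ naturalParams P ∧ cumulant P θ ≤ c := by
  constructor
  · intro h
    have hθ : θ ∈ naturalParams P := h.trans_lt ENNReal.ofReal_lt_top
    rw [laplace_eq P hθ, ENNReal.ofReal_le_ofReal_iff (Real.exp_pos c).le, Real.exp_le_exp] at h
    exact ⟨hθ, h⟩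
  · rintro ⟨hθ, h⟩
    rw [laplace_eq P hθ]
    exact ENNReal.ofReal_le_ofReal (Real.exp_le_exp.2 h)

theorem laplace_lt_iff (P : Measure (E d)) [IsProbabilityMeasure P] {θ : E d} {c : ℝ} :
    laplace P θ < ENNReal.ofReal (Real.exp c) ↔ θ ∈ naturalParams P ∧ cumulant P θ < c := by
  constructor
  · intro h
    have hθ : θ ∈ naturalParams P := h.trans ENNReal.ofReal_lt_top
    rw [laplace_eq P hθ, ENNReal.ofReal_lt_ofReal_iff (Real.exp_pos c), Real.exp_lt_exp] at h
    exact ⟨hθ, h⟩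
  · rintro ⟨hθ, h⟩
    rw [laplace_eq P hθ]
    exact (ENNReal.ofReal_lt_ofReal_iff (Real.exp_pos c)).2 (Real.exp_lt_exp.2 h)

theorem zero_mem_naturalParams (P : Measure (E d)) [IsProbabilityMeasure P] :
    (0 : E d) ∈ naturalParams P ∧ cumulant P 0 ≤ 0 := by
  rw [← laplace_le_iff]
  simp [laplace]

/-- Hölder's inequality for the weights `a`, `b`, followed by a logarithm. -/
theorem convexOn_cumulant (P : Measure (E d)) [IsProbabilityMeasure P] :
    ConvexOn ℝ (naturalParams P) (cumulant P) := by
  have key : ∀ x ∈ naturalParams P, ∀ y ∈ naturalParams P, ∀ a b : ℝ, 0 ≤ a → 0 ≤ b →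
      a + b = 1 → a • x + b • y ∈ naturalParams P ∧
        cumulant P (a • x + b • y) ≤ a • cumulant P x + b • cumulant P y := by
    intro x hx y hy a b ha hb hab
    rw [← laplace_le_iff]
    have h1 := ENNReal.lintegral_mul_norm_pow_le (μ := P) (measurable_exp_inner x).aemeasurable
      (measurable_exp_inner y).aemeasurable ha hb hab
    change _ ≤ (laplace P x) ^ a * (laplace P y) ^ b at h1
    rw [laplace_eq P hx, laplace_eq P hy] at h1
    simp only [ENNReal.ofReal_rpow_of_nonneg (Real.exp_pos _).le, ha, hb, ← Real.exp_mul,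
      ← ENNReal.ofReal_mul (Real.exp_pos _).le, ← Real.exp_add] at h1
    convert h1 using 3
    · simp only [laplace, inner_add_right, real_inner_smul_right, mul_comm]
    · simp only [smul_eq_mul, mul_comm]
  exact ⟨fun x hx y hy a b ha hb hab => (key x hx y hy a b ha hb hab).1,
    fun x hx y hy a b ha hb hab => (key x hx y hy a b ha hb hab).2⟩

/-- The closedness of the log-normalizer, by Fatou's lemma. -/
theorem cumulant_le_of_tendsto (P : Measure (E d)) [IsProbabilityMeasure P] {x : ℕ → E d}
    {θ : E d} {c : ℕ → ℝ} {c₀ : ℝ} (hx : Tendsto x atTop (𝓝 θ)) (hc : Tendsto c atTop (𝓝 c₀))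
    (h : ∀ k, x k ∈ naturalParams P ∧ cumulant P (x k) ≤ c k) :
    θ ∈ naturalParams P ∧ cumulant P θ ≤ c₀ := by
  rw [← laplace_le_iff]
  have hcont : Continuous fun t : ℝ => ENNReal.ofReal (Real.exp t) :=
    ENNReal.continuous_ofReal.comp Real.continuous_exp
  calc laplace P θ
      = ∫⁻ y, liminf (fun k => ENNReal.ofReal (Real.exp ⟪y, x k⟫_ℝ)) atTop ∂P := by
        refine lintegral_congr fun y => ?_
        have : Continuous fun t : E d => ENNReal.ofReal (Real.exp ⟪y, t⟫_ℝ) :=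
          ENNReal.continuous_ofReal.comp (by fun_prop : Continuous fun t : E d => Real.exp ⟪y, t⟫_ℝ)
        exact ((this.tendsto θ).comp hx).liminf_eq.symm
    _ ≤ liminf (fun k => laplace P (x k)) atTop :=
        lintegral_liminf_le fun k => measurable_exp_inner (x k)
    _ ≤ liminf (fun k => ENNReal.ofReal (Real.exp (c k))) atTop :=
        liminf_le_liminf (Eventually.of_forall fun k => (laplace_le_iff P).2 (h k))
    _ = ENNReal.ofReal (Real.exp c₀) := ((hcont.tendsto c₀).comp hc).liminf_eq

/-! ### The Cramér rate function -/

/-- Parameters outside `naturalParams P` contribute `⊥` to the supremum and can be dropped. -/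
theorem cramer_le_iff {P : Measure (E d)} {y : E d} {c : ℝ} :
    cramer P y ≤ (c : EReal) ↔ ∀ θ ∈ naturalParams P, ⟪y, θ⟫_ℝ - cumulant P θ ≤ c := by
  rw [cramer, conjugate, iSup_le_iff]
  refine forall_congr' fun θ => ?_
  by_cases h : θ ∈ naturalParams P
  · rw [logNormalizer_of_mem h, ← EReal.coe_sub, EReal.coe_le_coe_iff]
    simp [h]
  · simp [logNormalizer_of_notMem h, h]

theorem cramer_nonneg (P : Measure (E d)) [IsProbabilityMeasure P] (y : E d) :
    0 ≤ cramer P y := by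
  refine le_trans ?_ (le_iSup _ (0 : E d))
  obtain ⟨h0, h1⟩ := zero_mem_naturalParams P
  rw [logNormalizer_of_mem h0, ← EReal.coe_sub, ← EReal.coe_zero, EReal.coe_le_coe_iff]
  simpa using h1

theorem coe_toReal_cramer {P : Measure (E d)} [IsProbabilityMeasure P] {y : E d}
    (hy : y ∈ dom (cramer P)) : ((cramer P y).toReal : EReal) = cramer P y :=
  EReal.coe_toReal (ne_of_lt hy)
    (ne_of_gt (lt_of_lt_of_le EReal.bot_lt_zero (cramer_nonneg P y)))

theorem inner_sub_cumulant_le {P : Measure (E d)} [IsProbabilityMeasure P] {y θ : E d}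
    (hy : y ∈ dom (cramer P)) (hθ : θ ∈ naturalParams P) :
    ⟪y, θ⟫_ℝ - cumulant P θ ≤ (cramer P y).toReal :=
  cramer_le_iff.1 (coe_toReal_cramer hy).ge θ hθ

theorem mem_dom_cramer_iff {P : Measure (E d)} [IsProbabilityMeasure P] {y : E d} :
    y ∈ dom (cramer P) ↔ ∃ c : ℝ, cramer P y ≤ c :=
  ⟨fun h => ⟨_, (coe_toReal_cramer h).ge⟩, fun ⟨c, h⟩ => h.trans_lt (EReal.coe_lt_top c)⟩

theorem convexOn_cramer (P : Measure (E d)) [IsProbabilityMeasure P] :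
    ConvexOn ℝ (dom (cramer P)) fun y => (cramer P y).toReal := by
  have key : ∀ x ∈ dom (cramer P), ∀ y ∈ dom (cramer P), ∀ a b : ℝ, 0 ≤ a → 0 ≤ b →
      a + b = 1 → cramer P (a • x + b • y) ≤
        ((a * (cramer P x).toReal + b * (cramer P y).toReal : ℝ) : EReal) := by
    intro x hx y hy a b ha hb hab
    rw [cramer_le_iff]
    intro θ hθ
    have h1 := mul_le_mul_of_nonneg_left (inner_sub_cumulant_le hx hθ) ha
    have h2 := mul_le_mul_of_nonneg_left (inner_sub_cumulant_le hy hθ) hb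
    have h3 : cumulant P θ = a * cumulant P θ + b * cumulant P θ := by rw [← add_mul, hab, one_mul]
    rw [inner_add_left, real_inner_smul_left, real_inner_smul_left]
    linarith
  have hconv : Convex ℝ (dom (cramer P)) := fun x hx y hy a b ha hb hab =>
    mem_dom_cramer_iff.2 ⟨_, key x hx y hy a b ha hb hab⟩
  refine ⟨hconv, fun x hx y hy a b ha hb hab => ?_⟩
  have h := key x hx y hy a b ha hb hab
  rw [← coe_toReal_cramer (hconv hx hy ha hb hab), EReal.coe_le_coe_iff] at h
  exact h

theorem lowerSemicontinuous_cramer (P : Measure (E d)) : LowerSemicontinuous (cramer P) := by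
  refine lowerSemicontinuous_iSup fun θ => Continuous.lowerSemicontinuous ?_
  by_cases h : θ ∈ naturalParams P
  · simp only [logNormalizer_of_mem h, ← EReal.coe_sub]
    exact continuous_coe_real_ereal.comp (by fun_prop)
  · simp only [logNormalizer_of_notMem h, EReal.sub_top]
    exact continuous_const

/-- The Cramér rate function attains its minimum over closed sets that meet its domain. -/
theorem argmin_cramer_nonempty {P : Measure (E d)} [IsProbabilityMeasure P]
    (h0 : (0 : E d) ∈ interior (naturalParams P)) {S : Set (E d)} (hS : IsClosed S)
    (hSdom : (S ∩ dom (cramer P)).Nonempty) : (argmin (cramer P) S).Nonempty := by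
  obtain ⟨y₁, hy₁S, hy₁⟩ := hSdom
  obtain ⟨r, hr, M, hM⟩ := (convexOn_cumulant P).exists_closedBall_le h0
  set c := (cramer P y₁).toReal with hc
  have hclosed : IsClosed (S ∩ cramer P ⁻¹' Iic (c : EReal)) :=
    hS.inter ((lowerSemicontinuous_cramer P).isClosed_preimage _)
  -- On the ball of radius `r` the cumulant is at most `M`, so rate at most `c` forces `⟪y, u⟫ ≤ c +
  -- M` whenever `‖u‖ ≤ r`.
  have hbdd : S ∩ cramer P ⁻¹' Iic (c : EReal) ⊆ Metric.closedBall 0 ((c + M) / r) := by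
    rintro y ⟨-, hy⟩
    rw [mem_closedBall_zero_iff, le_div_iff₀ hr, mul_comm]
    refine mul_norm_le_of_inner_le hr fun u hu => ?_
    obtain ⟨hu1, hu2⟩ := hM u (by simpa using hu)
    have := cramer_le_iff.1 hy u hu1
    rw [real_inner_comm]
    linarith
  have hcomp : IsCompact (S ∩ cramer P ⁻¹' Iic (c : EReal)) :=
    (isCompact_closedBall _ _).of_isClosed_subset hclosed hbdd
  obtain ⟨y, ⟨hyS, hyc⟩, hmin⟩ := LowerSemicontinuousOn.exists_isMinOn
    (⟨y₁, hy₁S, (coe_toReal_cramer hy₁).ge⟩ : (S ∩ cramer P ⁻¹' Iic (c : EReal)).Nonempty) hcomp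
    ((lowerSemicontinuous_cramer P).lowerSemicontinuousOn _)
  refine ⟨y, hyS, fun z hz => ?_⟩
  rcases le_total (cramer P z) c with h | h
  · exact hmin ⟨hz, h⟩
  · exact le_trans hyc h

/-- At a minimizer of the Cramér rate function over a convex set that meets the interior of its
domain, the supremum in the definition of the rate function is attained. -/
theorem exists_inner_sub_cumulant_eq {P : Measure (E d)} [IsProbabilityMeasure P] {S : Set (E d)}
    (hS : Convex ℝ S) {y₀ y : E d} (hy₀ : y₀ ∈ interior (dom (cramer P)) ∩ S)
    (hy : y ∈ argmin (cramer P) S) (hyd : y ∈ dom (cramer P)) :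
    ∃ θ ∈ naturalParams P, ⟪y, θ⟫_ℝ - cumulant P θ = (cramer P y).toReal := by
  obtain ⟨r, hr, M, hM⟩ := (convexOn_cramer P).exists_closedBall_le hy₀.1
  set c := (cramer P y).toReal with hc
  set t : ℕ → ℝ := fun k => 1 / ((k : ℝ) + 1) with ht
  have ht0 : ∀ k, 0 < t k := fun k => by positivity
  have ht1 : ∀ k, t k ≤ 1 := fun k => by
    rw [ht, div_le_one (by positivity)]; linarith [k.cast_nonneg (α := ℝ)]
  have htlim : Tendsto t atTop (𝓝 0) := tendsto_one_div_add_atTop_nhds_zero_nat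
  -- The shifted point lies in `S`, so its rate is at least the minimum `c`, and some parameter
  -- comes within `t k` of `c`.
  have hex : ∀ k, ∃ θ ∈ naturalParams P,
      c - t k < ⟪y + t k • (y₀ - y), θ⟫_ℝ - cumulant P θ := by
    intro k
    by_contra! hcon
    have hmem : y + t k • (y₀ - y) ∈ S := by
      have := hS hy.1 hy₀.2 (by linarith [ht1 k] : 0 ≤ 1 - t k) (ht0 k).le (by ring)
      convert this using 1
      module
    have h := (hy.2 _ hmem).trans (cramer_le_iff.2 hcon)
    rw [← coe_toReal_cramer hyd, EReal.coe_le_coe_iff] at h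
    linarith [ht0 k]
  choose θ hθ hlt using hex
  -- Comparing near-optimality at the shifted point with the bound `c` at `y` gives `⟪y₀ - y, θ k⟫ >
  -- -1`. Hence `⟪y₀, θ k⟫ - cumulant P (θ k)` is at least `c - 2`, while the rate is at most `M` on
  -- the ball around `y₀`.
  have hbdd : ∀ k, θ k ∈ Metric.closedBall (0 : E d) ((M - c + 2) / r) := by
    intro k
    rw [mem_closedBall_zero_iff, le_div_iff₀ hr, mul_comm]
    refine mul_norm_le_of_inner_le hr fun u hu => ?_
    obtain ⟨hu1, hu2⟩ := hM (y₀ + u) (by simpa using hu)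
    have h1 := inner_sub_cumulant_le hu1 (hθ k)
    have h2 := inner_sub_cumulant_le hyd (hθ k)
    have h3 := hlt k
    simp only [inner_add_left, real_inner_smul_left, inner_sub_left] at h1 h2 h3
    have h4 : -1 < ⟪y₀, θ k⟫_ℝ - ⟪y, θ k⟫_ℝ := by
      by_contra! hcon
      have := mul_le_mul_of_nonneg_left hcon (ht0 k).le
      linarith
    nlinarith [ht0 k, ht1 k]
  obtain ⟨θ', -, φ, hφ, hlim⟩ := (isCompact_closedBall (0 : E d) _).tendsto_subseq hbdd
  have htφ : Tendsto (t ∘ φ) atTop (𝓝 0) := htlim.comp hφ.tendsto_atTop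
  have hup : Tendsto (fun k => ⟪y + (t ∘ φ) k • (y₀ - y), (θ ∘ φ) k⟫_ℝ - c + (t ∘ φ) k) atTop
      (𝓝 (⟪y + (0 : ℝ) • (y₀ - y), θ'⟫_ℝ - c + 0)) :=
    ((((htφ.smul_const _).const_add y).inner hlim).sub_const c).add htφ
  obtain ⟨hθ', hle⟩ := cumulant_le_of_tendsto P hlim hup fun k =>
    ⟨hθ (φ k), by have := hlt (φ k); simp only [Function.comp_apply]; linarith⟩
  refine ⟨θ', hθ', le_antisymm (inner_sub_cumulant_le hyd hθ') ?_⟩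
  rw [zero_smul, add_zero, add_zero] at hle
  linarith

/-! ### The domain of the rate function and the mass of the distribution -/

/-- Averages over bounded sets of positive probability lie in the domain of the rate function. -/
theorem setAverage_mem_dom_cramer {P : Measure (E d)} [IsProbabilityMeasure P] {A : Set (E d)}
    (hbdd : Bornology.IsBounded A) (hPA : P A ≠ 0) :
    (⨍ y in A, y ∂P) ∈ dom (cramer P) := by
  have hpos : 0 < P.real A := ENNReal.toReal_pos hPA (measure_ne_top P A)
  have hint : ∀ {F : Type} [NormedAddCommGroup F] (g : E d → F), Continuous g →
      IntegrableOn g A P := by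
    intro F _ g hg
    refine (hg.continuousOn.integrableOn_compact (hbdd.isCompact_closure)).mono_set subset_closure
  -- Jensen bounds `exp ⟪average, θ⟫` by `exp (cumulant P θ) / P.real A`; taking logarithms gives
  -- the constant.
  refine mem_dom_cramer_iff.2 ⟨-Real.log (P.real A), cramer_le_iff.2 fun θ hθ => ?_⟩
  have hconv : ConvexOn ℝ univ fun y : E d => Real.exp ⟪y, θ⟫_ℝ := by
    have h := convexOn_exp.comp_linearMap (innerₗ (E d) θ)
    simpa [Function.comp_def, real_inner_comm] using h
  have hcont : Continuous fun y : E d => Real.exp ⟪y, θ⟫_ℝ := by fun_prop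
  have hjensen := hconv.map_set_average_le hcont.continuousOn isClosed_univ hPA
    (measure_ne_top P A) (ae_of_all _ fun _ => mem_univ _) (hint (fun y => y) continuous_id)
    (hint _ hcont)
  have hset : ∫ y in A, Real.exp ⟪y, θ⟫_ℝ ∂P ≤ Real.exp (cumulant P θ) := by
    rw [integral_eq_lintegral_of_nonneg_ae (ae_of_all _ fun y => (Real.exp_pos _).le)
      hcont.aestronglyMeasurable]
    refine ENNReal.toReal_le_of_le_ofReal (Real.exp_pos _).le ?_
    rw [← laplace_eq P hθ]
    exact setLIntegral_le_lintegral _ _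
  rw [setAverage_eq P (fun y => Real.exp ⟪y, θ⟫_ℝ), smul_eq_mul, inv_mul_eq_div, le_div_iff₀ hpos] at hjensen
  have h := Real.log_le_log (by positivity) (hjensen.trans hset)
  rw [Real.log_mul (Real.exp_pos _).ne' hpos.ne', Real.log_exp, Real.log_exp] at h
  linarith

/-- Half-spaces that contain the domain of the rate function carry the distribution. -/
theorem ae_inner_le {P : Measure (E d)} [IsProbabilityMeasure P] {n : E d} {b : ℝ}
    (h : ∀ y ∈ dom (cramer P), ⟪n, y⟫_ℝ ≤ b) : ∀ᵐ y ∂P, ⟪n, y⟫_ℝ ≤ b := by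
  -- Closed, convex, bounded pieces exhausting the violating open half-space. If one had positive
  -- mass, its average would lie both in the piece and in the domain.
  set A : ℕ → Set (E d) := fun k =>
    {y | b + 1 / ((k : ℝ) + 1) ≤ ⟪n, y⟫_ℝ} ∩ Metric.closedBall 0 k with hAdef
  have hclosed : ∀ k, IsClosed (A k) := fun k =>
    (isClosed_le continuous_const (by fun_prop)).inter Metric.isClosed_closedBall
  have hconv : ∀ k, Convex ℝ (A k) := fun k =>
    (convex_halfSpace_ge (innerₗ (E d) n).isLinear _).inter (convex_closedBall _ _)
  have hnull : ∀ k, P (A k) = 0 := by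
    intro k
    by_contra hk
    have hb : Bornology.IsBounded (A k) := Metric.isBounded_closedBall.subset inter_subset_right
    have hmem : (⨍ y in A k, y ∂P) ∈ A k :=
      (hconv k).set_average_mem (hclosed k) hk (measure_ne_top P _)
        (ae_restrict_mem (hclosed k).measurableSet)
        ((continuous_id.continuousOn.integrableOn_compact hb.isCompact_closure).mono_set
          subset_closure)
    have h1 := h _ (setAverage_mem_dom_cramer hb hk)
    have h2 : (0 : ℝ) < 1 / ((k : ℝ) + 1) := by positivity
    have h3 := hmem.1
    simp only [mem_ofPred_eq] at h3
    linarith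
  refine measure_mono_null (fun y hy => ?_) (measure_iUnion_null hnull)
  have hy' : 0 < ⟪n, y⟫_ℝ - b := sub_pos.2 (not_le.1 hy)
  obtain ⟨k₁, hk₁⟩ := exists_nat_one_div_lt hy'
  obtain ⟨k₂, hk₂⟩ := exists_nat_ge ‖y‖
  refine mem_iUnion.2 ⟨max k₁ k₂, ?_, ?_⟩
  · have : 1 / (((max k₁ k₂ : ℕ) : ℝ) + 1) ≤ 1 / ((k₁ : ℝ) + 1) :=
      Nat.one_div_le_one_div (le_max_left _ _)
    simp only [mem_ofPred_eq]
    linarith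
  · rw [mem_closedBall_zero_iff]
    exact hk₂.trans (by exact_mod_cast le_max_right k₁ k₂)

/-- A distribution whose convex support has full dimension is not concentrated on a hyperplane. -/
theorem not_ae_inner_eq {Ω : Set (E d)} {P : Measure (E d)} (hdim : affineDim (convexSupp Ω P) = d)
    {n : E d} (hn : n ≠ 0) {b : ℝ} : ¬ ∀ᵐ y ∂P, ⟪n, y⟫_ℝ = b := by
  intro h
  set H : Set (E d) := {y | ⟪n, y⟫_ℝ = b} with hH
  have hclosed : IsClosed H := isClosed_eq (by fun_prop) continuous_const
  have hsub : convexSupp Ω P ⊆ H :=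
    closure_minimal (convexHull_min
      (inter_subset_left.trans (Measure.support_subset_of_isClosed hclosed h))
      (convex_hyperplane (innerₗ (E d) n).isLinear b)) hclosed
  have hdir : (affineSpan ℝ (convexSupp Ω P)).direction ≤ LinearMap.ker (innerₗ (E d) n) := by
    rw [direction_affineSpan, vectorSpan_def, Submodule.span_le]
    rintro _ ⟨x, hx, y, hy, rfl⟩
    have hx' : ⟪n, x⟫_ℝ = b := hsub hx
    have hy' : ⟪n, y⟫_ℝ = b := hsub hy
    simp [inner_sub_right, hx', hy']
  have htop : (affineSpan ℝ (convexSupp Ω P)).direction = ⊤ := by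
    apply Submodule.eq_top_of_finrank_eq
    rw [finrank_euclideanSpace_fin]
    exact hdim
  rw [htop, top_le_iff] at hdir
  have : n ∈ LinearMap.ker (innerₗ (E d) n) := hdir ▸ Submodule.mem_top
  exact hn (by simpa using this)

/-- The supremum in the definition of the rate function is attained only at interior points of
its domain. -/
theorem mem_interior_dom_cramer {Ω : Set (E d)} {P : Measure (E d)} [IsProbabilityMeasure P]
    (hdim : affineDim (convexSupp Ω P) = d) (hne : (interior (dom (cramer P))).Nonempty)
    {y θ : E d} (hy : y ∈ dom (cramer P)) (hθ : θ ∈ naturalParams P)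
    (heq : ⟪y, θ⟫_ℝ - cumulant P θ = (cramer P y).toReal) : y ∈ interior (dom (cramer P)) := by
  by_contra hyi
  have hconv := (convexOn_cramer P).1
  obtain ⟨f, hf⟩ := geometric_hahn_banach_open_point hconv.interior isOpen_interior hyi
  set n : E d := (InnerProductSpace.toDual ℝ (E d)).symm f with hn
  have hfn : ∀ x, f x = ⟪n, x⟫_ℝ := fun x => by
    rw [hn, InnerProductSpace.toDual_symm_apply]
  have hn0 : n ≠ 0 := by
    intro h0
    obtain ⟨x, hx⟩ := hne
    have := hf x hx
    simp [hfn, h0] at this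
  -- A convex set with nonempty interior lies in the closure of its interior, so the separation
  -- extends to the whole domain.
  have hle : ∀ x ∈ dom (cramer P), ⟪n, x⟫_ℝ ≤ ⟪n, y⟫_ℝ := by
    have hcl : closure (interior (dom (cramer P))) ⊆ {x | ⟪n, x⟫_ℝ ≤ ⟪n, y⟫_ℝ} :=
      closure_minimal (fun x hx => by have := hf x hx; rw [hfn, hfn] at this; exact this.le)
        (isClosed_le (by fun_prop) continuous_const)
    rw [hconv.closure_interior_eq_closure_of_nonempty_interior hne] at hcl
    exact subset_closure.trans hcl
  have hae := ae_inner_le hle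
  have hstrict : laplace P (θ + n) < ENNReal.ofReal (Real.exp (cumulant P θ + ⟪n, y⟫_ℝ)) := by
    have hrhs : ENNReal.ofReal (Real.exp (cumulant P θ + ⟪n, y⟫_ℝ)) =
        ∫⁻ x, ENNReal.ofReal (Real.exp (⟪x, θ⟫_ℝ + ⟪n, y⟫_ℝ)) ∂P := by
      simp only [Real.exp_add, ENNReal.ofReal_mul (Real.exp_pos _).le]
      rw [lintegral_mul_const _ (measurable_exp_inner θ), ← laplace_eq P hθ, laplace]
    have hmono : (fun x => ENNReal.ofReal (Real.exp ⟪x, θ + n⟫_ℝ)) ≤ᵐ[P]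
        fun x => ENNReal.ofReal (Real.exp (⟪x, θ⟫_ℝ + ⟪n, y⟫_ℝ)) := by
      filter_upwards [hae] with x hx
      refine ENNReal.ofReal_le_ofReal (Real.exp_le_exp.2 ?_)
      rw [inner_add_right, real_inner_comm n x]
      linarith
    have hmeas : Measurable fun x => ENNReal.ofReal (Real.exp (⟪x, θ⟫_ℝ + ⟪n, y⟫_ℝ)) :=
      (ENNReal.continuous_ofReal.comp
        (by fun_prop : Continuous fun x : E d => Real.exp (⟪x, θ⟫_ℝ + ⟪n, y⟫_ℝ))).measurable
    have hfin : laplace P (θ + n) ≠ ⊤ := by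
      refine ne_top_of_le_ne_top ?_ (lintegral_mono_ae hmono)
      rw [← hrhs]
      exact ENNReal.ofReal_ne_top
    rw [hrhs]
    refine lintegral_strict_mono_of_ae_le_of_frequently_ae_lt hmeas.aemeasurable hfin hmono ?_
    intro hcon
    refine not_ae_inner_eq hdim hn0 (b := ⟪n, y⟫_ℝ) ?_
    filter_upwards [hcon] with x hx
    have hx' := not_not.1 hx
    rw [ENNReal.ofReal_eq_ofReal_iff (Real.exp_pos _).le (Real.exp_pos _).le,
      Real.exp_eq_exp, inner_add_right, real_inner_comm n x] at hx'
    linarith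
  obtain ⟨h1, h2⟩ := (laplace_lt_iff P).1 hstrict
  have h3 := inner_sub_cumulant_le hy h1
  rw [inner_add_right, real_inner_comm n y] at h3
  linarith

/-- The log-normalizer of a steep family has at most one subgradient at each point. -/
theorem subgradient_unique {P : Measure (E d)} [IsProbabilityMeasure P] (hsteep : IsSteep P)
    (h0 : (0 : E d) ∈ interior (naturalParams P)) {y₁ y₂ θ : E d} (hθ : θ ∈ naturalParams P)
    (h₁ : ∀ x ∈ naturalParams P, ⟪y₁, x⟫_ℝ - cumulant P x ≤ ⟪y₁, θ⟫_ℝ - cumulant P θ)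
    (h₂ : ∀ x ∈ naturalParams P, ⟪y₂, x⟫_ℝ - cumulant P x ≤ ⟪y₂, θ⟫_ℝ - cumulant P θ) :
    y₁ = y₂ := by
  have hdiff := hsteep.differentiable
  have hst := hsteep.steep
  rw [dom_logNormalizer] at hdiff hst
  have hcvx := convexOn_cumulant P
  by_cases hi : θ ∈ interior (naturalParams P)
  -- At an interior point the maximality of `θ` is a first-order condition, which determines `y` as
  -- the derivative.
  · have key : ∀ y : E d, (∀ x ∈ naturalParams P,
        ⟪y, x⟫_ℝ - cumulant P x ≤ ⟪y, θ⟫_ℝ - cumulant P θ) →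
        innerSL ℝ y = fderiv ℝ (cumulant P) θ := by
      intro y hy
      have hmax : IsLocalMax (fun x => innerSL ℝ y x - cumulant P x) θ := by
        filter_upwards [mem_interior_iff_mem_nhds.1 hi] with x hx
        simpa using hy x hx
      have hd := ((innerSL ℝ y).hasFDerivAt (x := θ)).sub (hdiff θ hi).hasFDerivAt
      exact sub_eq_zero.1 (hmax.hasFDerivAt_eq_zero hd)
    have h := (key y₁ h₁).trans (key y₂ h₂).symm
    exact ext_inner_right ℝ fun v => by simpa using congrArg (fun f => f v) h
  -- At a boundary point a subgradient `y₁` would keep the gradients bounded along the segment from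
  -- `0` to `θ`, against steepness.
  · exfalso
    obtain ⟨r, hr, M, hM⟩ := hcvx.exists_closedBall_le h0
    set s : ℕ → ℝ := fun k => 1 / ((k : ℝ) + 1) with hs
    have hs0 : ∀ k, 0 < s k := fun k => by positivity
    have hs1 : ∀ k, s k ≤ 1 := fun k => by
      rw [hs, div_le_one (by positivity)]; linarith [k.cast_nonneg (α := ℝ)]
    have hslim : Tendsto s atTop (𝓝 0) := tendsto_one_div_add_atTop_nhds_zero_nat
    have hxi : ∀ k, (1 - s k) • θ ∈ interior (naturalParams P) := fun k => by
      have := hcvx.1.combo_interior_self_mem_interior h0 hθ (hs0 k)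
        (by linarith [hs1 k] : 0 ≤ 1 - s k) (by ring)
      simpa using this
    have hxlim : Tendsto (fun k => (1 - s k) • θ) atTop (𝓝 θ) := by
      simpa using (hslim.const_sub 1).smul_const θ
    have hfr : θ ∈ frontier (naturalParams P) := ⟨subset_closure hθ, hi⟩
    have htop := hst _ θ hxi hfr hxlim
    have hbound : ∀ k, ‖grad (logNormalizer P) ((1 - s k) • θ)‖ ≤
        (M - cumulant P θ + ⟪y₁, θ⟫_ℝ) / r := by
      intro k
      set g := grad (logNormalizer P) ((1 - s k) • θ) with hg
      have hgrad : ∀ z ∈ naturalParams P,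
          cumulant P ((1 - s k) • θ) + ⟪g, z - (1 - s k) • θ⟫_ℝ ≤ cumulant P z := fun z hz =>
        hcvx.add_inner_gradient_le (interior_subset (hxi k)) hz (hdiff _ (hxi k))
      have ha := hgrad θ hθ
      have hb := h₁ _ (interior_subset (hxi k))
      rw [inner_sub_right, real_inner_smul_right] at ha
      rw [real_inner_smul_right] at hb
      -- Monotonicity of subgradients between `(1 - s k) • θ` and `θ`, divided by `s k`.
      have hc : ⟪g, θ⟫_ℝ ≤ ⟪y₁, θ⟫_ℝ := le_of_mul_le_mul_left (by linarith) (hs0 k)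
      rw [le_div_iff₀ hr, mul_comm]
      refine mul_norm_le_of_inner_le hr fun u hu => ?_
      obtain ⟨hu1, hu2⟩ := hM u (by simpa using hu)
      have hd := hgrad u hu1
      rw [inner_sub_right, real_inner_smul_right] at hd
      rw [real_inner_comm]
      have := mul_le_mul_of_nonneg_left hc (by linarith [hs1 k] : 0 ≤ 1 - s k)
      linarith
    obtain ⟨k, hk⟩ := (htop.eventually_gt_atTop _).exists
    exact (hbound k).not_gt hk

end MEM

/-! ### The MEM estimator -/

theorem mainTheorem5 (d : ℕ) (Ω : Set (MEM.E d)) (ν : Measure (MEM.E d))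
    (hΩ : MEM.IsSampleSpace Ω ν)
    (Λ : Set (MEM.E d)) (P : Λ → Measure (MEM.E d))
    (hP : MEM.IsReferenceFamily ν Λ P)
    (hmin : ∀ l, MEM.MinimalSteep Ω (P l))
    (hsupp : ∀ l, MEM.SupportCondition Ω (P l))
    (yhat : MEM.E d) (lhat : Λ) (hyhat : yhat = MEM.mean (P lhat))
    (S : Set (MEM.E d)) (hS : IsClosed S)
    (hSdom : (S ∩ MEM.dom (MEM.cramer (P lhat))).Nonempty) :
    (MEM.argmin (MEM.cramer (P lhat)) S).Nonempty ∧
    (Convex ℝ S → (interior (MEM.dom (MEM.cramer (P lhat))) ∩ S).Nonempty →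
      ∃ y ∈ interior (MEM.dom (MEM.cramer (P lhat))) ∩ S,
        MEM.argmin (MEM.cramer (P lhat)) S = {y}) := by
  have : IsProbabilityMeasure (P lhat) := (hP.mem lhat).1
  have hms := hmin lhat
  have hne := MEM.argmin_cramer_nonempty hms.zero_mem hS hSdom
  refine ⟨hne, fun hconv hint => ?_⟩
  obtain ⟨z, hzS, hz⟩ := hSdom
  obtain ⟨y₀, hy₀⟩ := hint
  have hdom : ∀ y ∈ MEM.argmin (MEM.cramer (P lhat)) S, y ∈ MEM.dom (MEM.cramer (P lhat)) :=
    fun y hy => (hy.2 z hzS).trans_lt hz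
  obtain ⟨y, hy⟩ := hne
  have hyd := hdom y hy
  obtain ⟨θ, hθ, heq⟩ := MEM.exists_inner_sub_cumulant_eq hconv hy₀ hy hyd
  refine ⟨y, ⟨MEM.mem_interior_dom_cramer hms.minimal.2 ⟨y₀, hy₀.1⟩ hyd hθ heq, hy.1⟩,
    eq_singleton_iff_unique_mem.2 ⟨hy, fun w hw => ?_⟩⟩
  have hwd := hdom w hw
  have hval : (MEM.cramer (P lhat) w).toReal = (MEM.cramer (P lhat) y).toReal := by
    rw [le_antisymm (hw.2 y hy.1) (hy.2 w hw.1)]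
  have hmS : (1 / 2 : ℝ) • w + (1 / 2 : ℝ) • y ∈ S :=
    hconv hw.1 hy.1 (by norm_num) (by norm_num) (by norm_num)
  have hcvx := MEM.convexOn_cramer (P lhat)
  have hmd : (1 / 2 : ℝ) • w + (1 / 2 : ℝ) • y ∈ MEM.dom (MEM.cramer (P lhat)) :=
    hcvx.1 hwd hyd (by norm_num) (by norm_num) (by norm_num)
  have hmle := hcvx.2 hwd hyd (by norm_num : (0 : ℝ) ≤ 1 / 2) (by norm_num : (0 : ℝ) ≤ 1 / 2)
    (by norm_num)
  simp only [hval, smul_eq_mul] at hmle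
  have hmy : MEM.cramer (P lhat) ((1 / 2 : ℝ) • w + (1 / 2 : ℝ) • y) ≤ MEM.cramer (P lhat) y := by
    rw [← MEM.coe_toReal_cramer hyd, ← MEM.coe_toReal_cramer hmd, EReal.coe_le_coe_iff]
    linarith
  have hm : (1 / 2 : ℝ) • w + (1 / 2 : ℝ) • y ∈ MEM.argmin (MEM.cramer (P lhat)) S :=
    ⟨hmS, fun x hx => hmy.trans (hy.2 x hx)⟩
  have hmval := congrArg EReal.toReal (le_antisymm hmy (hy.2 _ hmS))
  -- At `η` the values for `w` and `y` average to the common minimum and neither exceeds it, so both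
  -- equal it: `η` is a maximizer for both points.
  obtain ⟨η, hη, hηeq⟩ := MEM.exists_inner_sub_cumulant_eq hconv hy₀ hm hmd
  rw [hmval, inner_add_left, real_inner_smul_left, real_inner_smul_left] at hηeq
  have hwη := MEM.inner_sub_cumulant_le hwd hη
  have hyη := MEM.inner_sub_cumulant_le hyd hη
  refine MEM.subgradient_unique hms.steep hms.zero_mem hη
    (fun x hx => (MEM.inner_sub_cumulant_le hwd hx).trans ?_)
    (fun x hx => (MEM.inner_sub_cumulant_le hyd hx).trans ?_) <;> linarith
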